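/- Let $\{\rho_\theta:\theta\in\Theta\subset\mathbb R^d\}$ be a family of quantum states (density operators) on a finite-dimensional Hilbert space $\mathcal H$, let $\theta_0$ be an interior point of $\Theta$, write $\rho=\rho_{\theta_0}$, and let $(L_1,\dots,L_d)$ be symmetric logarithmic derivatives at $\theta_0$, i.e. selfadjoint operators with $\partial_i\rho_\theta|_{\theta=\theta_0}=\frac12(\rho L_i+L_i\rho)$. Let $K_\rho=\{K: K\rho=\rho K=0\}$ and let $\mathcal D_\rho$ be the commutation operator: $\mathcal D_\rho X$ is the class modulo $K_\rho$ of the operators $Y$ with $\rho Y+Y\rho=\sqrt{-1}(\rho X-X\rho)$. Let $(X_1,\dots,X_r)$ be selfadjoint operators on $\mathcal H$ such that $\mathrm{Tr}\,\rho X_i=0$ for all $i$, the classes of $X_1,\dots,X_r$ modulo $K_\rho$ are linearly independent over $\mathbb R$, $\mathrm{Span}_{\mathbb R}\{L_k\}\subset V:=\mathrm{Span}_{\mathbb R}\{X_i\}$, and $V$ is $\mathcal D_\rho$-invariant (for each $X\in V$ the class $\mathcal D_\rho X$ contains an element of $V$). Put $$\Delta^{(n)}_k=\frac1{\sqrt n}\sum_{j=1}^n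 I^{\otimes(j-1)}\otimes L_k\otimes I^{\otimes(n-j)},\qquad X^{(n)}_i=\frac1{\sqrt n}\sum_{j=1}^n I^{\otimes(j-1)}\otimes X_i\otimes I^{\otimes(n-j)},$$ and $\Sigma_{ij}=\mathrm{Tr}\,\rho X_jX_i$, $A_{ij}=\mathrm{Tr}\sqrt\rho X_i\sqrt\rho X_j$. For positive semidefinite $P,Q$ let $P\#Q$ be their operator geometric mean, i.e. the largest $Z\ge0$ with $\begin{pmatrix}P&Z\\Z&Q\end{pmatrix}\ge0$. Then: 1. There is a real $r\times d$ matrix $F$ with $\Delta^{(n)}_k=\sum_{i=1}^r F^i_kX^{(n)}_i$ for all $n$ and $k$; and $r\ge d$ if $L_1,\dots,L_d$ are linearly independent. 2. $\Sigma\ge0$, $\mathrm{Re}\,\Sigma>0$, and $X^{(n)}$ converges in distribution under $\rho^{\otimes n}$ to the quantum Gaussian state $N(0,\Sigma)$, i.e. for all $T\in\mathbb N$ and $\xi_1,\dots,\xi_T\in\mathbb R^r$, $$\lim_{n\to\infty}\mathrm{Tr}\,\rho^{\otimes n}\prod_{t=1}^Te^{\sqrt{-1}\,\xi_t^iX^{(n)}_i}=\exp\Big(-\tfrac12\sum_{t}\xi_t^i\xi_t^j\Sigma_{ji}-\sum_{t<u}\xi_t^i\xi_u^j\Sigma_{ji}\Big).$$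 3. For all $\xi,\eta\in\mathbb R^r$, $$\lim_{n\to\infty}\mathrm{Tr}\sqrt{\rho^{\otimes n}}\,e^{\sqrt{-1}\,\xi^iX^{(n)}_i}\sqrt{\rho^{\otimes n}}\,e^{\sqrt{-1}\,\eta^iX^{(n)}_i}=\exp\left[-\frac12\begin{pmatrix}\xi\\\eta\end{pmatrix}^{\!\top}\begin{pmatrix}\Sigma&\Sigma\#\Sigma^\top\\\Sigma\#\Sigma^\top&\Sigma^\top\end{pmatrix}\begin{pmatrix}\xi\\\eta\end{pmatrix}\right],$$ and $A=\Sigma\#\Sigma^\top$. In particular, whenever the i.i.d. extension $\{\rho_\theta^{\otimes n}:\theta\in\Theta\}$ is quantum locally asymptotically normal (q-LAN) at $\theta_0$ with the observables $\Delta^{(n)}$, one has $r\ge d$ and the extension is $D$-extendible at $\theta_0$. Here q-LAN at $\theta_0$ with $\Delta^{(n)}$ means that $\Delta^{(n)}$ converges in distribution under $\rho_{\theta_0}^{\otimes n}$ to $N(0,J)$ for some $J\ge0$ with $\mathrm{Re}\,J>0$ and that, for every $h\in\mathbb R^d$, there are positive operators $R^{(n)}_h$ with $\rho_{\theta_0+h/\sqrt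 n}^{\otimes n}-R_h^{(n)}\rho_{\theta_0}^{\otimes n}R_h^{(n)}$ positive and of zero trace against $\rho_{\theta_0}^{\otimes n}$ (for large $n$) such that $\log\big(R^{(n)}_h+o_{L^2}\big)^2=h^i\Delta^{(n)}_i-\frac12(h^ih^jJ_{ij})I+o_D$, with selfadjoint remainders, where $\mathrm{Tr}\,\rho_{\theta_0}^{\otimes n}(o_{L^2})^2\to0$ and adding real multiples of $o_D$ to the exponents does not change the limits of $\mathrm{Tr}\,\rho_{\theta_0}^{\otimes n}\prod_te^{\sqrt{-1}\,\xi_t h^i\Delta^{(n)}_i}$. And $D$-extendible means that it is q-LAN in this sense and that some $r\ge d$ and observables $X_1^{(n)},\dots,X_r^{(n)}$ satisfy 1.-3. for some real $F$ and some $\Sigma\ge0$ with $\mathrm{Re}\,\Sigma>0$. -/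

import Mathlib

/-! Quantum systems on the finite-dimensional Hilbert space `ℂ^ι` are described by complex matrices
indexed by the finite type `ι`; the `n`-fold tensor power of `ℂ^ι` is `ℂ^(Fin n → ι)`. -/

open Filter Topology
open scoped ComplexOrder

noncomputable section

namespace QuantumIID

/-! ### States and functional calculus -/

/-- Quantum states (density matrices). -/
structure IsState {κ : Type*} [Fintype κ] (ρ : Matrix κ κ ℂ) : Prop where
  posSemidef : ρ.PosSemidef
  trace_eq_one : ρ.trace = 1

/-- The positive square root of a positive semidefinite matrix, by functional calculus. -/
def msqrt {κ : Type*} [Fintype κ] [DecidableEq κ] (A : Matrix κ κ ℂ) : Matrix κ κ ℂ :=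
  cfc Real.sqrt A

/-- The logarithm of a positive definite matrix, by functional calculus. -/
def mlog {κ : Type*} [Fintype κ] [DecidableEq κ] (A : Matrix κ κ ℂ) : Matrix κ κ ℂ :=
  cfc Real.log A

/-- The linear combination `ξ^i X_i` of observables with real coefficients. -/
def lin {κ : Type*} {r : ℕ} (ξ : Fin r → ℝ) (X : Fin r → Matrix κ κ ℂ) : Matrix κ κ ℂ :=
  ∑ i, (ξ i : ℂ) • X i

/-- The unitary `exp (√-1 A)`. -/
def expI {κ : Type*} [Fintype κ] [DecidableEq κ] (A : Matrix κ κ ℂ) : Matrix κ κ ℂ :=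
  NormedSpace.exp (Complex.I • A)

/-- A real vector, regarded as a complex one. -/
def toC {α : Type*} (ξ : α → ℝ) : α → ℂ := fun a => (ξ a : ℂ)

/-- The entrywise real part of a complex matrix. -/
def rePart {α : Type*} (J : Matrix α α ℂ) : Matrix α α ℝ := J.map Complex.re

/-! ### Tensor powers -/

/-- The tensor product `A 0 ⊗ ⋯ ⊗ A (n - 1)` acting on `(ℂ^ι)^{⊗ n}`. -/
def tensor {ι : Type*} {n : ℕ} (A : Fin n → Matrix ι ι ℂ) :
    Matrix (Fin n → ι) (Fin n → ι) ℂ :=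
  Matrix.of fun f g => ∏ k, A k (f k) (g k)

/-- The state `ρ^{⊗ n}`. -/
def tensorPow {ι : Type*} (n : ℕ) (ρ : Matrix ι ι ℂ) : Matrix (Fin n → ι) (Fin n → ι) ℂ :=
  tensor fun _ => ρ

/-- The scaled sum `n^{-1/2} ∑_k I ⊗ ⋯ ⊗ A ⊗ ⋯ ⊗ I`, with `A` at the `k`-th place. -/
def iidSum {ι : Type*} [DecidableEq ι] (n : ℕ) (A : Matrix ι ι ℂ) :
    Matrix (Fin n → ι) (Fin n → ι) ℂ :=
  (((Real.sqrt n)⁻¹ : ℝ) : ℂ) •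
    ∑ k : Fin n, tensor (Function.update (fun _ => (1 : Matrix ι ι ℂ)) k A)

/-! ### Symmetric logarithmic derivatives and the commutation operator -/

/-- `L` is a list of symmetric logarithmic derivatives at `θ₀` of the family `θ ↦ ρ θ`:
`∂_i ρ = (ρ L_i + L_i ρ) / 2` at `θ₀`, with `L_i` selfadjoint. -/
def IsSLD {ι : Type*} [Fintype ι] {d : ℕ} (ρ : (Fin d → ℝ) → Matrix ι ι ℂ) (θ₀ : Fin d → ℝ)
    (L : Fin d → Matrix ι ι ℂ) : Prop :=
  ∀ i, (L i).IsHermitian ∧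
    HasDerivAt (fun t : ℝ => ρ (θ₀ + t • Pi.single i 1))
      ((1 / 2 : ℂ) • (ρ θ₀ * L i + L i * ρ θ₀)) 0

/-- The space `K_ρ = {K : K ρ = ρ K = 0}`, as a real subspace of the matrices. -/
def kerSpace {ι : Type*} [Fintype ι] (ρ : Matrix ι ι ℂ) : Submodule ℝ (Matrix ι ι ℂ) where
  carrier := {K | K * ρ = 0 ∧ ρ * K = 0}
  add_mem' := by
    rintro a b ⟨h1, h2⟩ ⟨h3, h4⟩
    exact ⟨by rw [Matrix.add_mul, h1, h3, add_zero], by rw [Matrix.mul_add, h2, h4, add_zero]⟩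
  zero_mem' := ⟨Matrix.zero_mul _, Matrix.mul_zero _⟩
  smul_mem' := by
    rintro c a ⟨h1, h2⟩
    exact ⟨by rw [Matrix.smul_mul, h1, smul_zero], by rw [Matrix.mul_smul, h2, smul_zero]⟩

/-- `Y` represents `𝒟_ρ X` modulo `K_ρ`, where
`𝒟_ρ = √-1 (L_ρ - R_ρ) / (L_ρ + R_ρ)` with `L_ρ Z = ρ Z` and `R_ρ Z = Z ρ`. The kernel of
`L_ρ + R_ρ` is `K_ρ`, so this equation determines the class of `Y` modulo `K_ρ`, which
depends only on the class of `X`. -/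
def RepresentsCommutation {ι : Type*} [Fintype ι] (ρ X Y : Matrix ι ι ℂ) : Prop :=
  ρ * Y + Y * ρ = Complex.I • (ρ * X - X * ρ)

/-- A real subspace `V` of matrices is `𝒟_ρ`-invariant if its image modulo `K_ρ` is mapped into
itself by `𝒟_ρ`. -/
def IsCommutationInvariant {ι : Type*} [Fintype ι] (ρ : Matrix ι ι ℂ)
    (V : Submodule ℝ (Matrix ι ι ℂ)) : Prop :=
  ∀ X ∈ V, ∃ Y ∈ V, RepresentsCommutation ρ X Y

/-- The list `X` of selfadjoint matrices is a `𝒟_ρ`-invariant extension of the list `L`. -/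
structure IsInvariantExtension {ι : Type*} [Fintype ι] {d r : ℕ} (ρ : Matrix ι ι ℂ)
    (X : Fin r → Matrix ι ι ℂ) (L : Fin d → Matrix ι ι ℂ) : Prop where
  isHermitian : ∀ i, (X i).IsHermitian
  span_le : Submodule.span ℝ (Set.range L) ≤ Submodule.span ℝ (Set.range X)
  invariant : IsCommutationInvariant ρ (Submodule.span ℝ (Set.range X))

/-- The matrix `Σ_{ij} = Tr ρ X_j X_i`. -/
def covMatrix {ι : Type*} [Fintype ι] {r : ℕ} (ρ : Matrix ι ι ℂ) (X : Fin r → Matrix ι ι ℂ) :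
    Matrix (Fin r) (Fin r) ℂ :=
  Matrix.of fun i j => (ρ * X j * X i).trace

/-- The matrix `A_{ij} = Tr √ρ X_i √ρ X_j`. -/
def crossCovMatrix {ι : Type*} [Fintype ι] [DecidableEq ι] {r : ℕ} (ρ : Matrix ι ι ℂ)
    (X : Fin r → Matrix ι ι ℂ) : Matrix (Fin r) (Fin r) ℂ :=
  Matrix.of fun i j => (msqrt ρ * X i * msqrt ρ * X j).trace

/-- `G` is the operator geometric mean `P # Q`, that is, the greatest element, in the Loewner
order, of the set of all `Z ≥ 0` for which the block matrix `[[P, Z], [Z, Q]]` is positive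
semidefinite. -/
structure IsGeometricMean {m : Type*} [Fintype m] (P Q G : Matrix m m ℂ) : Prop where
  posSemidef : G.PosSemidef
  block_posSemidef : (Matrix.fromBlocks P G G Q).PosSemidef
  greatest : ∀ Z : Matrix m m ℂ, Z.PosSemidef → (Matrix.fromBlocks P Z Z Q).PosSemidef →
    (G - Z).PosSemidef

/-! ### Convergence in distribution -/

/-- The quasi-characteristic function of the quantum Gaussian state `N(h, J)`, evaluated at
`(ξ_1, …, ξ_T)`. -/
def gaussianQuasiChar {r : ℕ} (h : Fin r → ℝ) (J : Matrix (Fin r) (Fin r) ℂ) {T : ℕ}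
    (ξ : Fin T → Fin r → ℝ) : ℂ :=
  Complex.exp
    ((∑ t, (Complex.I * (∑ i, (ξ t i : ℂ) * (h i : ℂ))
        - (1 / 2) * ∑ i, ∑ j, (ξ t i : ℂ) * (ξ t j : ℂ) * J j i))
      - ∑ t, ∑ u ∈ Finset.Ioi t, ∑ i, ∑ j, (ξ t i : ℂ) * (ξ u j : ℂ) * J j i)

/-- Quantum convergence in distribution of the observables `X n` under the states `ρ n` to
`N(h, J)`: convergence of all quasi-characteristic functions. -/
def ConvergesToGaussian {κ : ℕ → Type*} [∀ n, Fintype (κ n)] [∀ n, DecidableEq (κ n)] {r : ℕ}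
    (ρ : ∀ n, Matrix (κ n) (κ n) ℂ) (X : ∀ n, Fin r → Matrix (κ n) (κ n) ℂ)
    (h : Fin r → ℝ) (J : Matrix (Fin r) (Fin r) ℂ) : Prop :=
  ∀ (T : ℕ) (ξ : Fin T → Fin r → ℝ),
    Tendsto (fun n => (ρ n * (List.ofFn fun t => expI (lin (ξ t) (X n))).prod).trace) atTop
      (𝓝 (gaussianQuasiChar h J ξ))

/-! ### Quantum local asymptotic normality -/

/-- `R` is a square-root likelihood ratio of `σ` relative to `ρ`: `R ≥ 0` and
`σ = R ρ R + σ^⊥` with `σ^⊥ ≥ 0` and `Tr ρ σ^⊥ = 0`. -/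
def IsSqrtLikelihoodRatio {κ : Type*} [Fintype κ] (R σ ρ : Matrix κ κ ℂ) : Prop :=
  R.PosSemidef ∧ (σ - R * ρ * R).PosSemidef ∧ (ρ * (σ - R * ρ * R)).trace = 0

/-- `O n = o_{L²}(ρ n)`. -/
def IsLittleOL2 {κ : ℕ → Type*} [∀ n, Fintype (κ n)] (ρ O : ∀ n, Matrix (κ n) (κ n) ℂ) : Prop :=
  (∀ n, (O n).IsHermitian) ∧ Tendsto (fun n => (ρ n * (O n * O n)).trace) atTop (𝓝 0)

/-- `Z n = o_D(Y n, ρ n)`: the observables `Z n` are infinitesimal in distribution relative to the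
observables `Y n` under the states `ρ n`. -/
def IsLittleOD {κ : ℕ → Type*} [∀ n, Fintype (κ n)] [∀ n, DecidableEq (κ n)]
    (ρ Y Z : ∀ n, Matrix (κ n) (κ n) ℂ) : Prop :=
  (∀ n, (Z n).IsHermitian) ∧
  ∀ (T : ℕ) (ξ η : Fin T → ℝ),
    Tendsto (fun n =>
      (ρ n * (List.ofFn fun t => expI ((ξ t : ℂ) • Y n + (η t : ℂ) • Z n)).prod).trace
        - (ρ n * (List.ofFn fun t => expI ((ξ t : ℂ) • Y n)).prod).trace) atTop (𝓝 0)

/-- The sequence of models `{ρ n θ : θ ∈ Θ}` is quantum locally asymptotically normal at `θ₀`, with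
the observables `Δ n` and the matrix `J`. -/
structure IsQLAN {κ : ℕ → Type*} [∀ n, Fintype (κ n)] [∀ n, DecidableEq (κ n)] {d : ℕ}
    (Θ : Set (Fin d → ℝ)) (ρ : ∀ n, (Fin d → ℝ) → Matrix (κ n) (κ n) ℂ) (θ₀ : Fin d → ℝ)
    (Δ : ∀ n, Fin d → Matrix (κ n) (κ n) ℂ) (J : Matrix (Fin d) (Fin d) ℂ) : Prop where
  state : ∀ n, ∀ θ ∈ Θ, IsState (ρ n θ)
  isHermitian : ∀ n i, (Δ n i).IsHermitian
  posSemidef : J.PosSemidef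
  re_posDef : (rePart J).PosDef
  converges : ConvergesToGaussian (fun n => ρ n θ₀) Δ 0 J
  /-- `log (R_h + o_{L²})² = h^i Δ_i - (1/2) (h^i h^j J_{ij}) I + o_D(h^i Δ_i)`. -/
  expansion : ∀ h : Fin d → ℝ, ∃ R O Z : ∀ n, Matrix (κ n) (κ n) ℂ,
    (∀ᶠ n : ℕ in atTop, θ₀ + (Real.sqrt n)⁻¹ • h ∈ Θ ∧
      IsSqrtLikelihoodRatio (R n) (ρ n (θ₀ + (Real.sqrt n)⁻¹ • h)) (ρ n θ₀)) ∧
    IsLittleOL2 (fun n => ρ n θ₀) O ∧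
    IsLittleOD (fun n => ρ n θ₀) (fun n => lin h (Δ n)) Z ∧
    ∀ᶠ n in atTop, (R n + O n).PosDef ∧
      mlog ((R n + O n) ^ 2) =
        lin h (Δ n) - ((1 / 2 : ℂ) * (toC h ⬝ᵥ J.mulVec (toC h))) • 1 + Z n

/-! ### D-extensions -/

/-- The three conditions for the observables `X n` to be a D-extension of the observables `Δ n`
under the states `ρ n`, with coefficient matrix `F` and limiting covariance matrix `Sig`. -/
structure DExtensionConditions {κ : ℕ → Type*} [∀ n, Fintype (κ n)] [∀ n, DecidableEq (κ n)]
    {d r : ℕ} (ρ : ∀ n, Matrix (κ n) (κ n) ℂ) (Δ : ∀ n, Fin d → Matrix (κ n) (κ n) ℂ)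
    (X : ∀ n, Fin r → Matrix (κ n) (κ n) ℂ) (F : Matrix (Fin r) (Fin d) ℝ)
    (Sig : Matrix (Fin r) (Fin r) ℂ) : Prop where
  isHermitian : ∀ n i, (X n i).IsHermitian
  /-- `Δ_k = ∑_i F_k^i X_i`. -/
  eq_lin : ∀ n k, Δ n k = ∑ i, (F i k : ℂ) • X n i
  posSemidef : Sig.PosSemidef
  re_posDef : (rePart Sig).PosDef
  converges : ConvergesToGaussian ρ X 0 Sig
  /-- The sandwiched characteristic function converges to the Gaussian one with the blocks `Sig`,
  `Sig # Sigᵀ`, `Sig # Sigᵀ`, `Sigᵀ`. -/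
  sandwiched : ∃ G, IsGeometricMean Sig Sig.transpose G ∧
    ∀ ξ η : Fin r → ℝ,
      Tendsto (fun n => (msqrt (ρ n) * expI (lin ξ (X n)) * msqrt (ρ n) *
          expI (lin η (X n))).trace) atTop
        (𝓝 (Complex.exp (-(1 / 2) *
          (toC (Sum.elim ξ η) ⬝ᵥ
            (Matrix.fromBlocks Sig G G Sig.transpose).mulVec (toC (Sum.elim ξ η))))))

/-- The sequence of models `{ρ n θ : θ ∈ Θ}`, q-LAN at `θ₀` with the observables `Δ n`, is
D-extendible at `θ₀`. -/
def IsDExtendible {κ : ℕ → Type*} [∀ n, Fintype (κ n)] [∀ n, DecidableEq (κ n)] {d : ℕ}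
    (Θ : Set (Fin d → ℝ)) (ρ : ∀ n, (Fin d → ℝ) → Matrix (κ n) (κ n) ℂ) (θ₀ : Fin d → ℝ)
    (Δ : ∀ n, Fin d → Matrix (κ n) (κ n) ℂ) (J : Matrix (Fin d) (Fin d) ℂ) : Prop :=
  IsQLAN Θ ρ θ₀ Δ J ∧
  ∃ r : ℕ, d ≤ r ∧ ∃ (X : ∀ n, Fin r → Matrix (κ n) (κ n) ℂ) (F : Matrix (Fin r) (Fin d) ℝ)
    (Sig : Matrix (Fin r) (Fin r) ℂ), DExtensionConditions (fun n => ρ n θ₀) Δ X F Sig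

end QuantumIID

end

noncomputable section

namespace QuantumIID

open Matrix

/-!
Write `ℓ` and `𝓇` for left and right multiplication by `ρ`. On the support of `ρ` the commutation
operator is a function of `ℓ(ℓ + 𝓇)⁻¹`, so `D_ρ`-invariance of `V` says that the complexification of
`V` is invariant under `ℓ(ℓ + 𝓇)⁻¹`, which is self-adjoint for the inner product `Re Σ`. An
eigenbasis diagonalizes `Σ + Σᵀ = 2 Re Σ`, `Σ`, `Σᵀ` and `A` by one congruence, to `1`, `α`, `1 - α`
and `√(α(1 - α))`. Hence `A = Σ # Σᵀ`: that the diagonal square root is maximal is a Lyapunov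
comparison.

Both limits reduce to the `n`-th power of a one-site trace whose second-order expansion is
`1 + c/n + o(1/n)`, and `(1 + c/n + o(1/n))ⁿ → exp c`. For q-LAN families, a non-degenerate
Gaussian limit of `Δ⁽ⁿ⁾` forces the `L_k` to be linearly independent, whence `d ≤ r`.
-/

/-! ### Square roots -/

section Sqrt

variable {κ : Type*} [Fintype κ] [DecidableEq κ]

open scoped MatrixOrder in
lemma msqrt_eq_sqrt {A : Matrix κ κ ℂ} (hA : A.PosSemidef) : msqrt A = CFC.sqrt A := by
  rw [msqrt, CFC.sqrt_eq_real_sqrt A hA.nonneg, cfcₙ_eq_cfc]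

open scoped MatrixOrder in
lemma msqrt_posSemidef {A : Matrix κ κ ℂ} (hA : A.PosSemidef) : (msqrt A).PosSemidef := by
  rw [msqrt_eq_sqrt hA]
  exact (CFC.sqrt_nonneg A).posSemidef

open scoped MatrixOrder in
lemma msqrt_mul_msqrt {A : Matrix κ κ ℂ} (hA : A.PosSemidef) : msqrt A * msqrt A = A := by
  rw [msqrt_eq_sqrt hA]
  exact CFC.sqrt_mul_sqrt_self A hA.nonneg

open scoped MatrixOrder in
lemma msqrt_mul_self {A : Matrix κ κ ℂ} (hA : A.PosSemidef) : msqrt (A * A) = A := by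
  have hAA : (A * A).PosSemidef := by
    simpa only [hA.isHermitian.eq] using posSemidef_conjTranspose_mul_self A
  rw [msqrt_eq_sqrt hAA]
  exact CFC.sqrt_mul_self A hA.nonneg

omit [DecidableEq κ] in
lemma mul_eq_zero_of_trace_conjTranspose_mul_mul_eq_zero {A B : Matrix κ κ ℂ} (hA : A.PosSemidef)
    (h : (Bᴴ * A * B).trace = 0) : A * B = 0 := by
  classical
  have hsqrt := msqrt_mul_msqrt hA
  have hgram : (msqrt A * B)ᴴ * (msqrt A * B) = Bᴴ * A * B := by
    rw [conjTranspose_mul, (msqrt_posSemidef hA).isHermitian.eq, Matrix.mul_assoc,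
      ← Matrix.mul_assoc (msqrt A), hsqrt, Matrix.mul_assoc]
  rw [← hgram, trace_conjTranspose_mul_self_eq_zero_iff] at h
  rw [← hsqrt, Matrix.mul_assoc, h, Matrix.mul_zero]

lemma sqrt_mul_eq_of_eq_mul_add {p q α : ℝ} (hp : 0 ≤ p) (hq : 0 ≤ q) (h : p = α * (p + q)) :
    √p * √q = √(α * (1 - α)) * (p + q) := by
  have hpq : p * q = α * (1 - α) * (p + q) ^ 2 := by
    linear_combination (q - α * (p + q)) * h
  rw [← Real.sqrt_mul hp, hpq, Real.sqrt_mul' _ (sq_nonneg _), Real.sqrt_sq (add_nonneg hp hq)]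

-- In an eigenbasis of `ρ` with eigenvalues `p`, the hypothesis says `p i = α * (p i + p j)`
-- wherever the entry `Z i j` does not vanish.
lemma msqrt_mul_mul_msqrt_of_mul_eq_smul {ρ Z : Matrix κ κ ℂ} (hρ : ρ.PosSemidef) {α : ℝ}
    (h : ρ * Z = (α : ℂ) • (ρ * Z + Z * ρ)) :
    msqrt ρ * Z * msqrt ρ = (√(α * (1 - α)) : ℂ) • (ρ * Z + Z * ρ) := by
  have hH := hρ.isHermitian
  set p := hH.eigenvalues
  set φ := Unitary.conjStarAlgAut ℂ (Matrix κ κ ℂ) hH.eigenvectorUnitary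
  have hspec : ρ = φ (diagonal fun i => (p i : ℂ)) := hH.spectral_theorem
  have hsqrt : msqrt ρ = φ (diagonal fun i => (√(p i) : ℂ)) := hH.cfc_eq Real.sqrt
  obtain ⟨Z, rfl⟩ := EquivLike.surjective φ Z
  rw [hspec, ← map_mul, ← map_mul, ← map_add, ← map_smul, (EquivLike.injective φ).eq_iff] at h
  rw [hsqrt, hspec, ← map_mul, ← map_mul, ← map_mul, ← map_mul, ← map_add, ← map_smul,
    (EquivLike.injective φ).eq_iff]
  ext i j
  have hij := congrFun₂ h i j
  simp only [Matrix.smul_apply, Matrix.add_apply, diagonal_mul, mul_diagonal, smul_eq_mul] at hij ⊢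
  rcases eq_or_ne (Z i j) 0 with hZ | hZ
  · simp [hZ]
  have heig : p i = α * (p i + p j) := by
    exact_mod_cast mul_right_cancel₀ hZ (by linear_combination hij :
      (p i : ℂ) * Z i j = α * (p i + p j) * Z i j)
  have hroot : (√(p i) : ℂ) * √(p j) = √(α * (1 - α)) * (p i + p j) := by
    exact_mod_cast sqrt_mul_eq_of_eq_mul_add (hρ.eigenvalues_nonneg i) (hρ.eigenvalues_nonneg j)
      heig
  linear_combination Z i j * hroot

end Sqrt

/-! ### The geometric mean of a commuting pair -/

section GeometricMean

variable {m : Type*} [Fintype m]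

omit [Fintype m] in
lemma isClosed_posSemidef [Finite m] : IsClosed {A : Matrix m m ℂ | A.PosSemidef} := by
  cases nonempty_fintype m
  simp only [posSemidef_iff_dotProduct_mulVec, IsHermitian, Set.ofPred_and, Set.ofPred_forall]
  refine (isClosed_eq (by fun_prop) (by fun_prop)).inter (isClosed_iInter fun x => ?_)
  exact isClosed_le (by fun_prop) (by fun_prop)

lemma posSemidef_of_posSemidef_mul_add_mul {C N : Matrix m m ℂ} (hC : C.PosDef)
    (hN : N.IsHermitian) (h : (C * N + N * C).PosSemidef) : N.PosSemidef := by
  classical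
  rw [hN.posSemidef_iff_eigenvalues_nonneg]
  intro i
  set x : m → ℂ := ⇑(hN.eigenvectorBasis i)
  set ν := hN.eigenvalues i
  have hx : x ≠ 0 := by simpa [x] using hN.eigenvectorBasis.orthonormal.ne_zero i
  have hNx : N *ᵥ x = (ν : ℂ) • x := by
    simpa only [Complex.coe_smul] using hN.mulVec_eigenvectorBasis i
  have hxN : star x ᵥ* N = (ν : ℂ) • star x := by
    simpa [star_mulVec, hN.eq] using congrArg star hNx
  have hform : star x ⬝ᵥ (C * N + N * C) *ᵥ x = ((2 * ν : ℝ) : ℂ) * (star x ⬝ᵥ C *ᵥ x) := by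
    rw [add_mulVec, dotProduct_add, ← mulVec_mulVec, hNx, ← mulVec_mulVec, dotProduct_mulVec _ N,
      hxN, mulVec_smul, dotProduct_smul, smul_dotProduct, smul_eq_mul]
    push_cast
    ring
  have hpos := h.dotProduct_mulVec_nonneg x
  rw [hform] at hpos
  have hν : ((0 : ℝ) : ℂ) ≤ (2 * ν : ℝ) :=
    le_of_mul_le_mul_right (by simpa using hpos) (hC.dotProduct_mulVec_pos hx)
  exact nonneg_of_mul_nonneg_right (Complex.real_le_real.1 hν) two_pos

lemma posSemidef_of_posSemidef_fromBlocks {n : Type*} [Finite n]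
    {P : Matrix m m ℂ} {M : Matrix m n ℂ} {N : Matrix n m ℂ} {Q : Matrix n n ℂ}
    (h : (fromBlocks P M N Q).PosSemidef) (C : Matrix m n ℂ) :
    (Cᴴ * P * C - Cᴴ * M - N * C + Q).PosSemidef := by
  classical
  cases nonempty_fintype n
  convert h.conjTranspose_mul_mul_same (fromRows C (-1)) using 1
  rw [conjTranspose_fromRows_eq_fromCols_conjTranspose, fromCols_mul_fromBlocks,
    fromCols_mul_fromRows]
  simp only [conjTranspose_neg, conjTranspose_one, Matrix.neg_mul, Matrix.mul_neg, Matrix.one_mul,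
    Matrix.mul_one, Matrix.add_mul]
  abel

variable [DecidableEq m]

-- For `C = √(Q / P)` and `G = √(P Q)` the congruence turns the block matrix into
-- `C * (G - M) + (G - M) * C`.
omit [Fintype m] in
lemma diagonal_sqrt_sub_posSemidef_of_pos [Finite m] {a b : m → ℝ} (ha : ∀ k, 0 < a k)
    (hb : ∀ k, 0 < b k) {M : Matrix m m ℂ} (h : (fromBlocks (diagonal fun k => (a k : ℂ)) M M
      (diagonal fun k => (b k : ℂ))).PosSemidef) :
    ((diagonal fun k => (√(a k * b k) : ℂ)) - M).PosSemidef := by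
  cases nonempty_fintype m
  set c : m → ℝ := fun k => √(b k) / √(a k)
  set C : Matrix m m ℂ := diagonal fun k => (c k : ℂ)
  set G : Matrix m m ℂ := diagonal fun k => (√(a k * b k) : ℂ)
  have hC : C.PosDef := PosDef.diagonal fun k => by
    exact_mod_cast div_pos (Real.sqrt_pos.2 (hb k)) (Real.sqrt_pos.2 (ha k))
  have hG : G.IsHermitian := isHermitian_diagonal_of_self_adjoint _ (by ext; simp)
  have hM : M.IsHermitian := (isHermitian_fromBlocks_iff.1 h.isHermitian).2.1
  have hcg (k : m) : c k * √(a k * b k) = b k := by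
    have := Real.sqrt_pos.2 (ha k)
    simp only [c, Real.sqrt_mul (ha k).le]
    field_simp
    exact Real.sq_sqrt (hb k).le
  have hcac (k : m) : c k * a k * c k = b k := by
    have := Real.sqrt_pos.2 (ha k)
    simp only [c]
    field_simp
    rw [Real.sq_sqrt (ha k).le, Real.sq_sqrt (hb k).le, mul_comm]
  have hCG : C * G = diagonal fun k => (b k : ℂ) := by
    rw [diagonal_mul_diagonal]
    simp only [← Complex.ofReal_mul, hcg]
  have hGC : G * C = diagonal fun k => (b k : ℂ) := by
    rw [← hCG]
    exact (commute_diagonal _ _).eq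
  have hCPC : Cᴴ * (diagonal fun k => (a k : ℂ)) * C = diagonal fun k => (b k : ℂ) := by
    rw [hC.isHermitian.eq, diagonal_mul_diagonal, diagonal_mul_diagonal]
    simp only [← Complex.ofReal_mul, hcac]
  refine posSemidef_of_posSemidef_mul_add_mul hC (hG.sub hM) ?_
  convert posSemidef_of_posSemidef_fromBlocks h C using 1
  rw [hCPC, hC.isHermitian.eq, Matrix.mul_sub, Matrix.sub_mul, hCG, hGC]
  abel

omit [Fintype m] in
lemma diagonal_sqrt_sub_posSemidef [Finite m] {a b : m → ℝ} (ha : ∀ k, 0 ≤ a k) (hb : ∀ k, 0 ≤ b k)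
    {M : Matrix m m ℂ} (h : (fromBlocks (diagonal fun k => (a k : ℂ)) M M
      (diagonal fun k => (b k : ℂ))).PosSemidef) :
    ((diagonal fun k => (√(a k * b k) : ℂ)) - M).PosSemidef := by
  have hlim : Tendsto (fun ε : ℝ => (diagonal fun k => (√((a k + ε) * (b k + ε)) : ℂ)) - M)
      (𝓝[>] 0) (𝓝 ((diagonal fun k => (√(a k * b k) : ℂ)) - M)) := by
    have hcont : Continuous fun ε : ℝ =>
        (diagonal fun k => (√((a k + ε) * (b k + ε)) : ℂ)) - M := by fun_prop
    simpa using hcont.continuousWithinAt.tendsto (x := 0) (s := Set.Ioi 0)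
  refine isClosed_posSemidef.mem_of_tendsto hlim ?_
  filter_upwards [self_mem_nhdsWithin] with ε (hε : 0 < ε)
  refine diagonal_sqrt_sub_posSemidef_of_pos (fun k => add_pos_of_nonneg_of_pos (ha k) hε)
    (fun k => add_pos_of_nonneg_of_pos (hb k) hε) ?_
  convert h.add (PosSemidef.one.smul (by exact_mod_cast hε.le : (0 : ℂ) ≤ ε)) using 1
  rw [← fromBlocks_one, fromBlocks_smul, fromBlocks_add]
  simp [smul_one_eq_diagonal]

lemma isGeometricMean_diagonal {a b : m → ℝ} (ha : ∀ k, 0 ≤ a k) (hb : ∀ k, 0 ≤ b k) :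
    IsGeometricMean (diagonal fun k => (a k : ℂ)) (diagonal fun k => (b k : ℂ))
      (diagonal fun k => (√(a k * b k) : ℂ)) where
  posSemidef := PosSemidef.diagonal fun k => by simp [Real.sqrt_nonneg]
  block_posSemidef := by
    convert posSemidef_conjTranspose_mul_self (fromCols (diagonal fun k => (√(a k) : ℂ))
      (diagonal fun k => (√(b k) : ℂ))) using 1
    rw [conjTranspose_fromCols_eq_fromRows_conjTranspose, fromRows_mul_fromCols]
    simp [← Complex.ofReal_mul, Real.mul_self_sqrt, Real.sqrt_mul, ha, hb, mul_comm]
  greatest _ _ hZ := diagonal_sqrt_sub_posSemidef ha hb hZ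

lemma IsGeometricMean.of_congruence {P Q G W : Matrix m m ℂ} (hW : IsUnit W)
    (h : IsGeometricMean (Wᴴ * P * W) (Wᴴ * Q * W) (Wᴴ * G * W)) : IsGeometricMean P Q G := by
  have hblock (Z : Matrix m m ℂ) : (fromBlocks P Z Z Q).PosSemidef ↔
      (fromBlocks (Wᴴ * P * W) (Wᴴ * Z * W) (Wᴴ * Z * W) (Wᴴ * Q * W)).PosSemidef := by
    have hWW : IsUnit (fromBlocks W 0 0 W) := isUnit_fromBlocks_zero₂₁.2 ⟨hW, hW⟩
    rw [← IsUnit.posSemidef_star_left_conjugate_iff hWW, star_eq_conjTranspose]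
    simp only [fromBlocks_conjTranspose, fromBlocks_multiply, conjTranspose_zero, Matrix.mul_zero,
      Matrix.zero_mul, add_zero, zero_add]
  refine ⟨?_, (hblock G).2 h.block_posSemidef, fun Z hZ hPZQ => ?_⟩
  · exact (IsUnit.posSemidef_star_left_conjugate_iff hW).1 h.posSemidef
  · rw [← IsUnit.posSemidef_star_left_conjugate_iff hW, star_eq_conjTranspose, Matrix.mul_sub,
      Matrix.sub_mul]
    exact h.greatest _ (hZ.conjTranspose_mul_mul_same W) ((hblock Z).1 hPZQ)

open scoped MatrixOrder in
lemma exists_isUnit_conjTranspose_mul_self_eq {𝕜 : Type*} [RCLike 𝕜] {B : Matrix m m 𝕜}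
    (hB : B.PosDef) : ∃ R : Matrix m m 𝕜, IsUnit R ∧ Rᴴ * R = B := by
  obtain ⟨R, hR⟩ := CStarAlgebra.nonneg_iff_eq_star_mul_self.1 hB.posSemidef.nonneg
  have hdet := (isUnit_iff_isUnit_det _).1 hB.isUnit
  rw [hR, det_mul] at hdet
  exact ⟨R, (isUnit_iff_isUnit_det R).2 (isUnit_of_mul_isUnit_right hdet), hR.symm⟩

lemma exists_simultaneous_diagonalization {B S : Matrix m m ℂ} (hB : B.PosDef)
    (hS : S.IsHermitian) :
    ∃ (W : Matrix m m ℂ) (α : m → ℝ), IsUnit W ∧ Wᴴ * B * W = 1 ∧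
      Wᴴ * S * W = diagonal fun k => (α k : ℂ) := by
  obtain ⟨R, hR, rfl⟩ := exists_isUnit_conjTranspose_mul_self_eq hB
  have hS' : ((R⁻¹)ᴴ * S * R⁻¹).IsHermitian := isHermitian_conjTranspose_mul_mul _ hS
  set U : Matrix m m ℂ := ↑hS'.eigenvectorUnitary
  have hU : Uᴴ * U = 1 := Unitary.coe_star_mul_self _
  have hdiag : Uᴴ * ((R⁻¹)ᴴ * S * R⁻¹) * U = diagonal fun k => (hS'.eigenvalues k : ℂ) := by
    have := hS'.conjStarAlgAut_star_eigenvectorUnitary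
    rwa [Unitary.conjStarAlgAut_star_apply] at this
  refine ⟨R⁻¹ * U, hS'.eigenvalues, ?_, ?_, ?_⟩
  · exact (isUnit_nonsing_inv_iff.2 hR).mul Unitary.isUnit_coe
  · calc (R⁻¹ * U)ᴴ * (Rᴴ * R) * (R⁻¹ * U) = (R * R⁻¹ * U)ᴴ * (R * R⁻¹ * U) := by
          simp only [conjTranspose_mul, Matrix.mul_assoc]
      _ = 1 := by rw [mul_nonsing_inv _ ((isUnit_iff_isUnit_det R).1 hR), Matrix.one_mul, hU]
  · rw [← hdiag, conjTranspose_mul]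
    simp only [Matrix.mul_assoc]

end GeometricMean

/-! ### Covariance matrices -/

section Covariance

variable {ι : Type*} [Fintype ι]

/-- The matrix of the trace form `(Y, Z) ↦ Tr Y S Z T` on the family `X`. It is `Σ` for
`(S, T) = (ρ, 1)`, its transpose for `(S, T) = (1, ρ)`, and the cross-covariance matrix for
`(S, T) = (√ρ, √ρ)`. -/
def traceFormMatrix {α : Type*} (S T : Matrix ι ι ℂ) (X : α → Matrix ι ι ℂ) : Matrix α α ℂ :=
  Matrix.of fun i j => (X i * S * X j * T).trace

section TraceForm

variable {α : Type*} [Fintype α] (S T : Matrix ι ι ℂ) (X : α → Matrix ι ι ℂ)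

lemma traceFormMatrix_mulVec (z : α → ℂ) (i : α) :
    (traceFormMatrix S T X *ᵥ z) i =
      (X i * S * Fintype.linearCombination ℂ X z * T).trace := by
  simp [mulVec, dotProduct, traceFormMatrix, Fintype.linearCombination_apply, Finset.mul_sum,
    Finset.sum_mul, trace_sum, mul_comm]

lemma dotProduct_traceFormMatrix_mulVec (w z : α → ℂ) :
    w ⬝ᵥ traceFormMatrix S T X *ᵥ z = (Fintype.linearCombination ℂ X w * S *
      Fintype.linearCombination ℂ X z * T).trace := by
  simp only [dotProduct, traceFormMatrix_mulVec]
  simp only [Fintype.linearCombination_apply ℂ X w, Finset.sum_mul, trace_sum, Matrix.smul_mul,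
    trace_smul, smul_eq_mul]

omit [Fintype ι] in
lemma conjTranspose_linearCombination {X : α → Matrix ι ι ℂ} (hX : ∀ i, (X i).IsHermitian)
    (z : α → ℂ) :
    (Fintype.linearCombination ℂ X z)ᴴ = Fintype.linearCombination ℂ X (star z) := by
  simp [Fintype.linearCombination_apply, conjTranspose_sum, (hX _).eq]

end TraceForm

variable {r : ℕ} {ρ : Matrix ι ι ℂ} {X : Fin r → Matrix ι ι ℂ}

omit [Fintype ι] in
lemma lin_isHermitian (hX : ∀ i, (X i).IsHermitian) (ξ : Fin r → ℝ) : (lin ξ X).IsHermitian := by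
  simp [lin, IsHermitian, conjTranspose_sum, (hX _).eq]

lemma covMatrix_eq_traceFormMatrix [DecidableEq ι] :
    covMatrix ρ X = traceFormMatrix ρ 1 X := by
  ext i j
  simp only [covMatrix, traceFormMatrix, of_apply, Matrix.mul_one]
  rw [trace_mul_comm, ← Matrix.mul_assoc]

lemma transpose_covMatrix_eq_traceFormMatrix [DecidableEq ι] :
    (covMatrix ρ X)ᵀ = traceFormMatrix 1 ρ X := by
  ext i j
  simp only [covMatrix, traceFormMatrix, transpose_apply, of_apply, Matrix.mul_one]
  rw [Matrix.mul_assoc, trace_mul_comm]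

lemma crossCovMatrix_eq_traceFormMatrix [DecidableEq ι] :
    crossCovMatrix ρ X = traceFormMatrix (msqrt ρ) (msqrt ρ) X := by
  ext i j
  simp only [crossCovMatrix, traceFormMatrix, of_apply]
  rw [Matrix.mul_assoc, Matrix.mul_assoc, trace_mul_comm]
  simp only [Matrix.mul_assoc]

lemma dotProduct_covMatrix_mulVec (ξ η : Fin r → ℝ) :
    toC ξ ⬝ᵥ covMatrix ρ X *ᵥ toC η = (lin ξ X * ρ * lin η X).trace := by
  classical
  rw [covMatrix_eq_traceFormMatrix, dotProduct_traceFormMatrix_mulVec, Matrix.mul_one]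
  rfl

lemma covMatrix_posSemidef (hρ : ρ.PosSemidef) (hX : ∀ i, (X i).IsHermitian) :
    (covMatrix ρ X).PosSemidef := by
  classical
  refine .of_dotProduct_mulVec_nonneg ?_ fun z => ?_
  · ext i j
    simp only [covMatrix, conjTranspose_apply, of_apply, ← trace_conjTranspose, conjTranspose_mul,
      (hX _).eq, hρ.isHermitian.eq]
    rw [trace_mul_comm, Matrix.mul_assoc, trace_mul_comm]
  · rw [covMatrix_eq_traceFormMatrix, dotProduct_traceFormMatrix_mulVec, Matrix.mul_one,
      ← conjTranspose_linearCombination hX]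
    exact (hρ.conjTranspose_mul_mul_same _).trace_nonneg

lemma dotProduct_rePart_mulVec {m : Type*} [Fintype m] (J : Matrix m m ℂ) (ξ : m → ℝ) :
    ξ ⬝ᵥ rePart J *ᵥ ξ = (toC ξ ⬝ᵥ J *ᵥ toC ξ).re := by
  simp [dotProduct, mulVec, rePart, toC, Finset.mul_sum]

lemma eq_zero_of_lin_mem_kerSpace (hX : LinearIndependent ℝ fun i => (kerSpace ρ).mkQ (X i))
    {ξ : Fin r → ℝ} (hξ : lin ξ X ∈ kerSpace ρ) : ξ = 0 := by
  refine funext (Fintype.linearIndependent_iff.1 hX ξ ?_)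
  simpa only [lin, Complex.coe_smul, ← map_smul, ← map_sum, ← LinearMap.mem_ker,
    Submodule.ker_mkQ] using hξ

lemma rePart_covMatrix_posDef (hρ : ρ.PosSemidef) (hX : ∀ i, (X i).IsHermitian)
    (hXind : LinearIndependent ℝ fun i => (kerSpace ρ).mkQ (X i)) :
    (rePart (covMatrix ρ X)).PosDef := by
  have hcov := covMatrix_posSemidef hρ hX
  refine .of_dotProduct_mulVec_pos ?_ fun ξ hξ => ?_
  · ext i j
    simpa [rePart] using congrArg Complex.re (hcov.isHermitian.apply i j)
  set Y := lin ξ X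
  have hY : Yᴴ = Y := (lin_isHermitian hX ξ).eq
  have hnonneg : 0 ≤ (Yᴴ * ρ * Y).trace := (hρ.conjTranspose_mul_mul_same Y).trace_nonneg
  rw [star_trivial, dotProduct_rePart_mulVec, dotProduct_covMatrix_mulVec]
  change 0 < (Y * ρ * Y).trace.re
  nth_rewrite 1 [← hY]
  refine (Complex.pos_iff.1 (hnonneg.lt_of_ne fun hzero => hξ ?_)).1
  have hρY := mul_eq_zero_of_trace_conjTranspose_mul_mul_eq_zero hρ hzero.symm
  have hYρ : Y * ρ = 0 := by
    simpa only [conjTranspose_mul, hρ.isHermitian.eq, hY, conjTranspose_zero] using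
      congrArg conjTranspose hρY
  exact eq_zero_of_lin_mem_kerSpace hXind ⟨hYρ, hρY⟩

lemma posDef_map_ofReal {m : Type*} [Finite m] {P : Matrix m m ℝ} (hP : P.PosDef) :
    (P.map Complex.ofReal).PosDef := by
  classical
  cases nonempty_fintype m
  obtain ⟨R, hR, rfl⟩ := exists_isUnit_conjTranspose_mul_self_eq hP
  have hRC : IsUnit (R.map Complex.ofReal) := hR.map Complex.ofRealHom.mapMatrix
  have hmap : (Rᴴ * R).map Complex.ofReal =
      (R.map Complex.ofReal)ᴴ * R.map Complex.ofReal := by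
    ext i j
    simp [Matrix.mul_apply]
  rw [hmap]
  exact .conjTranspose_mul_self _ (mulVec_injective_iff_isUnit.2 hRC)

lemma covMatrix_add_transpose_posDef (hcov : (covMatrix ρ X).IsHermitian)
    (hpos : (rePart (covMatrix ρ X)).PosDef) : (covMatrix ρ X + (covMatrix ρ X)ᵀ).PosDef := by
  have hadd : covMatrix ρ X + (covMatrix ρ X)ᵀ =
      (rePart (covMatrix ρ X)).map Complex.ofReal +
        (rePart (covMatrix ρ X)).map Complex.ofReal := by
    ext i j
    rw [Matrix.add_apply, transpose_apply, ← hcov.apply j i]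
    simp [rePart, Complex.add_conj, two_mul]
  rw [hadd]
  exact (posDef_map_ofReal hpos).add (posDef_map_ofReal hpos)

lemma exists_mul_eq_mul_add_mul {s : Set (Matrix ι ι ℂ)}
    (hs : IsCommutationInvariant ρ (Submodule.span ℝ s)) {Z : Matrix ι ι ℂ}
    (hZ : Z ∈ Submodule.span ℂ s) : ∃ Y ∈ Submodule.span ℂ s, ρ * Z = ρ * Y + Y * ρ := by
  induction hZ using Submodule.span_induction with
  | mem X hX =>
    obtain ⟨Y, hY, hXY⟩ := hs X (Submodule.subset_span hX)
    have hY' : Y ∈ Submodule.span ℂ s := Submodule.span_le_restrictScalars ℝ ℂ s hY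
    refine ⟨(1 / 2 : ℂ) • (X - Complex.I • Y),
      Submodule.smul_mem _ _ (sub_mem (Submodule.subset_span hX) (Submodule.smul_mem _ _ hY')), ?_⟩
    have hIXY : Complex.I • (ρ * Y + Y * ρ) = -(ρ * X - X * ρ) := by
      rw [hXY, smul_smul, Complex.I_mul_I, neg_one_smul]
    simp only [Matrix.mul_smul, Matrix.smul_mul, Matrix.mul_sub, Matrix.sub_mul, smul_add,
      smul_sub] at hIXY ⊢
    linear_combination (norm := module) (1 / 2 : ℂ) • hIXY
  | zero => exact ⟨0, zero_mem _, by simp⟩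
  | add Z₁ Z₂ _ _ h₁ h₂ =>
    obtain ⟨Y₁, hY₁, h₁⟩ := h₁
    obtain ⟨Y₂, hY₂, h₂⟩ := h₂
    refine ⟨Y₁ + Y₂, add_mem hY₁ hY₂, ?_⟩
    rw [Matrix.mul_add, h₁, h₂, Matrix.mul_add, Matrix.add_mul]
    abel
  | smul c Z _ h =>
    obtain ⟨Y, hY, h⟩ := h
    refine ⟨c • Y, Submodule.smul_mem _ _ hY, ?_⟩
    rw [Matrix.mul_smul, h, Matrix.mul_smul, Matrix.smul_mul, smul_add]

lemma crossCovMatrix_mulVec_of_covMatrix_mulVec [DecidableEq ι] (hρ : ρ.PosSemidef)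
    (hX : IsCommutationInvariant ρ (Submodule.span ℝ (Set.range X)))
    (hB : (covMatrix ρ X + (covMatrix ρ X)ᵀ).PosDef) {z : Fin r → ℂ} {α : ℝ}
    (hz : covMatrix ρ X *ᵥ z = (α : ℂ) • (covMatrix ρ X + (covMatrix ρ X)ᵀ) *ᵥ z) :
    crossCovMatrix ρ X *ᵥ z =
      (√(α * (1 - α)) : ℂ) • (covMatrix ρ X + (covMatrix ρ X)ᵀ) *ᵥ z := by
  set B := covMatrix ρ X + (covMatrix ρ X)ᵀ
  have hBapply (w : Fin r → ℂ) (i : Fin r) : (B *ᵥ w) i =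
      (X i * (ρ * Fintype.linearCombination ℂ X w +
        Fintype.linearCombination ℂ X w * ρ)).trace := by
    rw [add_mulVec, Pi.add_apply, transpose_covMatrix_eq_traceFormMatrix,
      covMatrix_eq_traceFormMatrix, traceFormMatrix_mulVec, traceFormMatrix_mulVec, Matrix.mul_one,
      Matrix.mul_one, Matrix.mul_assoc, Matrix.mul_assoc, Matrix.mul_add, trace_add]
  obtain ⟨Y, hY, hYz⟩ := exists_mul_eq_mul_add_mul hX (Z := Fintype.linearCombination ℂ X z)
    ((Submodule.mem_span_range_iff_exists_fun ℂ).2 ⟨z, rfl⟩)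
  obtain ⟨w, rfl⟩ : ∃ w, Fintype.linearCombination ℂ X w = Y :=
    (Submodule.mem_span_range_iff_exists_fun ℂ).1 hY
  have hBw : B *ᵥ w = covMatrix ρ X *ᵥ z := by
    ext i
    rw [hBapply, covMatrix_eq_traceFormMatrix, traceFormMatrix_mulVec, Matrix.mul_one,
      Matrix.mul_assoc, hYz]
  have hwz : w = (α : ℂ) • z := mulVec_injective_iff_isUnit.2 hB.isUnit (by
    rw [hBw, hz, mulVec_smul])
  have heigen : ρ * Fintype.linearCombination ℂ X z = (α : ℂ) •
      (ρ * Fintype.linearCombination ℂ X z + Fintype.linearCombination ℂ X z * ρ) := by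
    rwa [hwz, map_smul, Matrix.mul_smul, Matrix.smul_mul, ← smul_add] at hYz
  ext i
  rw [crossCovMatrix_eq_traceFormMatrix, traceFormMatrix_mulVec, Matrix.mul_assoc (X i),
    Matrix.mul_assoc (X i), msqrt_mul_mul_msqrt_of_mul_eq_smul hρ heigen, Pi.smul_apply, hBapply,
    Matrix.mul_smul, trace_smul]

omit [Fintype ι] in
lemma mul_eq_mul_mul_diagonal_iff {m R : Type*} [Fintype m] [DecidableEq m] [CommSemiring R]
    {M B W : Matrix m m R} {v : m → R} :
    M * W = B * W * diagonal v ↔ ∀ k, M *ᵥ W.col k = v k • B *ᵥ W.col k := by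
  simp only [← Matrix.ext_iff, mul_diagonal, funext_iff, Pi.smul_apply, smul_eq_mul]
  rw [forall_comm]
  simp only [mul_comm _ (v _)]
  rfl

theorem isGeometricMean_crossCovMatrix [DecidableEq ι] (hρ : ρ.PosSemidef)
    (hXh : ∀ i, (X i).IsHermitian)
    (hX : IsCommutationInvariant ρ (Submodule.span ℝ (Set.range X)))
    (hpos : (rePart (covMatrix ρ X)).PosDef) :
    IsGeometricMean (covMatrix ρ X) (covMatrix ρ X)ᵀ (crossCovMatrix ρ X) := by
  have hcov := covMatrix_posSemidef hρ hXh
  have hB := covMatrix_add_transpose_posDef hcov.isHermitian hpos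
  obtain ⟨W, α, hW, hWB, hWcov⟩ := exists_simultaneous_diagonalization hB hcov.isHermitian
  have hWtr : Wᴴ * (covMatrix ρ X)ᵀ * W = diagonal fun k => ((1 - α k : ℝ) : ℂ) := by
    rw [Matrix.mul_add, Matrix.add_mul, hWcov] at hWB
    rw [eq_sub_of_add_eq' hWB, ← diagonal_one, diagonal_sub]
    simp
  have hcovW : covMatrix ρ X * W =
      (covMatrix ρ X + (covMatrix ρ X)ᵀ) * W * diagonal fun k => (α k : ℂ) := by
    refine hW.star.mul_left_cancel ?_
    rw [star_eq_conjTranspose, ← Matrix.mul_assoc, ← Matrix.mul_assoc, ← Matrix.mul_assoc, hWB,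
      hWcov, Matrix.one_mul]
  have hcrossW : crossCovMatrix ρ X * W = (covMatrix ρ X + (covMatrix ρ X)ᵀ) * W *
      diagonal fun k => (√(α k * (1 - α k)) : ℂ) :=
    mul_eq_mul_mul_diagonal_iff.2 fun k => crossCovMatrix_mulVec_of_covMatrix_mulVec hρ hX hB
      (mul_eq_mul_mul_diagonal_iff.1 hcovW k)
  have hWcross : Wᴴ * crossCovMatrix ρ X * W =
      diagonal fun k => (√(α k * (1 - α k)) : ℂ) := by
    rw [Matrix.mul_assoc, hcrossW, ← Matrix.mul_assoc, ← Matrix.mul_assoc, hWB, Matrix.one_mul]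
  have hα (k) : 0 ≤ α k := by
    have h := hWcov ▸ hcov.conjTranspose_mul_mul_same W
    exact_mod_cast posSemidef_diagonal_iff.1 h k
  have hα' (k) : 0 ≤ 1 - α k := by
    have h := hWtr ▸ hcov.transpose.conjTranspose_mul_mul_same W
    exact_mod_cast posSemidef_diagonal_iff.1 h k
  refine .of_congruence hW ?_
  rw [hWcov, hWtr, hWcross]
  exact isGeometricMean_diagonal hα hα'

end Covariance

/-! ### Tensor products of matrices -/

section Tensor

variable {ι : Type*} {n : ℕ}

lemma conjTranspose_tensor (A : Fin n → Matrix ι ι ℂ) : (tensor A)ᴴ = tensor fun k => (A k)ᴴ := by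
  ext f g
  simp [tensor]

variable [Fintype ι]

lemma tensor_mul (A B : Fin n → Matrix ι ι ℂ) : tensor (A * B) = tensor A * tensor B := by
  classical
  ext f g
  simp only [tensor, mul_apply, of_apply, Pi.mul_apply, Finset.prod_univ_sum,
    Fintype.piFinset_univ, Finset.prod_mul_distrib]

lemma trace_tensor (A : Fin n → Matrix ι ι ℂ) : (tensor A).trace = ∏ k, (A k).trace := by
  classical
  simp only [trace, diag_apply, tensor, of_apply, Finset.prod_univ_sum, Fintype.piFinset_univ]

lemma trace_tensorPow (A : Matrix ι ι ℂ) : (tensorPow n A).trace = A.trace ^ n := by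
  simp [tensorPow, trace_tensor]

variable [DecidableEq ι]

omit [Fintype ι] in
lemma tensor_one : tensor (1 : Fin n → Matrix ι ι ℂ) = 1 := by
  ext f g
  simp only [tensor, of_apply, Pi.one_apply, one_apply, Finset.prod_ite_zero,
    Finset.prod_const_one, Finset.mem_univ, true_implies, funext_iff]

/-- The tensor product of `n` matrices, as a monoid homomorphism. -/
def tensorHom (n : ℕ) : (Fin n → Matrix ι ι ℂ) →* Matrix (Fin n → ι) (Fin n → ι) ℂ where
  toFun := tensor
  map_one' := tensor_one
  map_mul' := tensor_mul

/-- The tensor power, as a monoid homomorphism. -/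
def tensorPowHom (n : ℕ) : Matrix ι ι ℂ →* Matrix (Fin n → ι) (Fin n → ι) ℂ :=
  (tensorHom n).comp (Pi.constMonoidHom (Fin n) (Matrix ι ι ℂ))

lemma tensorPowHom_apply (A : Matrix ι ι ℂ) : tensorPowHom n A = tensorPow n A := rfl

omit [Fintype ι] [DecidableEq ι] in
lemma tensor_posSemidef [Finite ι] {A : Fin n → Matrix ι ι ℂ} (hA : ∀ k, (A k).PosSemidef) :
    (tensor A).PosSemidef := by
  classical
  cases nonempty_fintype ι
  have hsqrt : A = (fun k => (msqrt (A k))ᴴ) * fun k => msqrt (A k) := funext fun k => by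
    rw [Pi.mul_apply, (msqrt_posSemidef (hA k)).isHermitian.eq, msqrt_mul_msqrt (hA k)]
  rw [hsqrt, tensor_mul, ← conjTranspose_tensor]
  exact posSemidef_conjTranspose_mul_self _

lemma msqrt_tensorPow {A : Matrix ι ι ℂ} (hA : A.PosSemidef) :
    msqrt (tensorPow n A) = tensorPow n (msqrt A) := by
  conv_lhs => rw [← msqrt_mul_msqrt hA]
  rw [← tensorPowHom_apply, map_mul]
  exact msqrt_mul_self (tensor_posSemidef fun _ => msqrt_posSemidef hA)

omit [Fintype ι] in
lemma tensor_mulSingle_apply (k : Fin n) (A : Matrix ι ι ℂ) (f g : Fin n → ι) :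
    tensor (Pi.mulSingle k A) f g =
      A (f k) (g k) * ∏ j ∈ Finset.univ.erase k, (1 : Matrix ι ι ℂ) (f j) (g j) := by
  rw [tensor, of_apply, ← Finset.mul_prod_erase _ _ (Finset.mem_univ k), Pi.mulSingle_eq_same]
  congr 1
  exact Finset.prod_congr rfl fun j hj => by
    rw [Pi.mulSingle_eq_of_ne (Finset.ne_of_mem_erase hj)]

/-- The embedding `A ↦ I ⊗ ⋯ ⊗ A ⊗ ⋯ ⊗ I` with `A` at the `k`-th place, as an algebra
homomorphism. -/
def place (k : Fin n) : Matrix ι ι ℂ →ₐ[ℂ] Matrix (Fin n → ι) (Fin n → ι) ℂ :=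
  AlgHom.ofLinearMap
    { toFun := fun A => tensor (Pi.mulSingle k A)
      map_add' := fun A B => by
        ext f g
        simp only [Matrix.add_apply, tensor_mulSingle_apply, add_mul]
      map_smul' := fun c A => by
        ext f g
        simp only [Matrix.smul_apply, tensor_mulSingle_apply, smul_eq_mul, RingHom.id_apply,
          mul_assoc] }
    (map_one ((tensorHom n).comp (MonoidHom.mulSingle _ k)))
    (map_mul ((tensorHom n).comp (MonoidHom.mulSingle _ k)))

lemma place_apply (k : Fin n) (A : Matrix ι ι ℂ) :
    place k A = tensorHom n (Pi.mulSingle k A) := rfl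

lemma commute_place {j k : Fin n} (hjk : j ≠ k) (A B : Matrix ι ι ℂ) :
    Commute (place j A) (place k B) := by
  rw [place_apply, place_apply]
  exact (Pi.mulSingle_commute (f := fun _ : Fin n => Matrix ι ι ℂ) hjk A B).map (tensorHom n)

lemma conjTranspose_place (k : Fin n) (A : Matrix ι ι ℂ) : (place k A)ᴴ = place k Aᴴ := by
  change (tensor (Pi.mulSingle k A))ᴴ = tensor (Pi.mulSingle k Aᴴ)
  rw [conjTranspose_tensor]
  congr 1
  exact funext (Pi.apply_mulSingle (fun _ => conjTranspose) (fun _ => conjTranspose_one) k A)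

open scoped Matrix.Norms.Operator in
lemma place_exp (k : Fin n) (A : Matrix ι ι ℂ) :
    place k (NormedSpace.exp A) = NormedSpace.exp (place k A) :=
  NormedSpace.map_exp (place k) (place k).toLinearMap.continuous_of_finiteDimensional A

lemma exp_sum_place (A : Fin n → Matrix ι ι ℂ) :
    NormedSpace.exp (∑ k, place k (A k)) = tensor fun k => NormedSpace.exp (A k) := by
  rw [Matrix.exp_sum_of_commute _ _ fun j _ k _ hjk => commute_place hjk _ _]
  simp only [← place_exp]
  simp only [place_apply]
  rw [← Finset.map_noncommProd _ _
    fun j _ k _ _ => Pi.mulSingle_apply_commute (fun k => NormedSpace.exp (A k)) j k,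
    Finset.noncommProd_mulSingle]
  rfl

lemma iidSum_eq_sum_place (A : Matrix ι ι ℂ) :
    iidSum n A = (((√n)⁻¹ : ℝ) : ℂ) • ∑ k : Fin n, place k A := rfl

omit [Fintype ι] in
lemma iidSum_isHermitian [Finite ι] {A : Matrix ι ι ℂ} (hA : A.IsHermitian) :
    (iidSum n A).IsHermitian := by
  cases nonempty_fintype ι
  simp [IsHermitian, iidSum_eq_sum_place, conjTranspose_sum, conjTranspose_place, hA.eq]

omit [Fintype ι] in
lemma lin_iidSum [Finite ι] {r : ℕ} (ξ : Fin r → ℝ) (X : Fin r → Matrix ι ι ℂ) :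
    lin ξ (fun i => iidSum n (X i)) = iidSum n (lin ξ X) := by
  cases nonempty_fintype ι
  simp only [lin, iidSum_eq_sum_place, map_sum, map_smul, Finset.smul_sum]
  rw [Finset.sum_comm]
  simp only [smul_comm (ξ _ : ℂ)]

lemma expI_iidSum (A : Matrix ι ι ℂ) :
    expI (iidSum n A) =
      tensorPow n (NormedSpace.exp ((((√n)⁻¹ : ℝ) : ℂ) • (Complex.I • A))) := by
  rw [tensorPow, ← exp_sum_place, expI, iidSum_eq_sum_place]
  simp only [map_smul, ← Finset.smul_sum]
  rw [smul_comm]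

end Tensor

/-! ### Second-order expansions -/

section Expansion

open Asymptotics

variable {𝕜 𝔸 : Type*} [RCLike 𝕜] [NormedRing 𝔸] [NormedAlgebra 𝕜 𝔸]

/-- The expansion `f z = a + z b + z² c + o(z²)` as `z → 0`. -/
def HasQuadraticExpansion (f : 𝕜 → 𝔸) (a b c : 𝔸) : Prop :=
  (fun z => f z - (a + z • b + z ^ 2 • c)) =o[𝓝 0] fun z : 𝕜 => z ^ 2

namespace HasQuadraticExpansion

variable {f g : 𝕜 → 𝔸} {a b c a' b' c' : 𝔸}

lemma const (a : 𝔸) : HasQuadraticExpansion (fun _ : 𝕜 => a) a 0 0 := by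
  simp [HasQuadraticExpansion]

lemma isBigO_one (hf : HasQuadraticExpansion f a b c) : f =O[𝓝 0] fun _ => (1 : 𝕜) := by
  have hpoly : (fun z : 𝕜 => a + z • b + z ^ 2 • c) =O[𝓝 0] fun _ => (1 : 𝕜) :=
    (Continuous.tendsto (by fun_prop) 0).isBigO_one 𝕜
  have hsq : (fun z : 𝕜 => z ^ 2) =O[𝓝 0] fun _ => (1 : 𝕜) :=
    (Continuous.tendsto (by fun_prop) 0).isBigO_one 𝕜
  simpa using (hf.isBigO.trans hsq).add hpoly

lemma mul (hf : HasQuadraticExpansion f a b c) (hg : HasQuadraticExpansion g a' b' c') :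
    HasQuadraticExpansion (fun z => f z * g z) (a * a') (a * b' + b * a')
      (a * c' + b * b' + c * a') := by
  have hpoly : (fun z : 𝕜 => a + z • b + z ^ 2 • c) =O[𝓝 0] fun _ => (1 : 𝕜) :=
    (Continuous.tendsto (by fun_prop) 0).isBigO_one 𝕜
  have hleft : (fun z => (f z - (a + z • b + z ^ 2 • c)) * g z) =o[𝓝 0] fun z : 𝕜 => z ^ 2 := by
    simpa using hf.mul_isBigO hg.isBigO_one
  have hright : (fun z => (a + z • b + z ^ 2 • c) * (g z - (a' + z • b' + z ^ 2 • c')))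
      =o[𝓝 0] fun z : 𝕜 => z ^ 2 := by
    simpa using hpoly.mul_isLittleO hg
  have hcubic : (fun z : 𝕜 => z ^ 3 • (b * c' + c * b' + z • (c * c'))) =o[𝓝 0]
      fun z : 𝕜 => z ^ 2 := by
    have hO : (fun z : 𝕜 => b * c' + c * b' + z • (c * c')) =O[𝓝 0] fun _ => (1 : 𝕜) :=
      (Continuous.tendsto (by fun_prop) 0).isBigO_one 𝕜
    simpa using (isLittleO_pow_pow (𝕜 := 𝕜) (by norm_num : 2 < 3)).smul_isBigO hO
  refine ((hleft.add hright).add hcubic).congr_left fun z => ?_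
  simp only [sub_mul, mul_sub, add_mul, mul_add, smul_mul_assoc, mul_smul_comm, smul_add, smul_smul]
  module

lemma exp [CompleteSpace 𝔸] (B : 𝔸) :
    HasQuadraticExpansion (fun z : 𝕜 => NormedSpace.exp (z • B)) 1 B
      ((1 / 2 : 𝕜) • (B * B)) := by
  have hz : Tendsto (fun z : 𝕜 => z • B) (𝓝 0) (𝓝 0) := by
    have hcont : Continuous fun z : 𝕜 => z • B := by fun_prop
    simpa using hcont.tendsto 0
  have hremainder := ((NormedSpace.exp_hasFPowerSeriesAt_zero (𝕂 := 𝕜)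
    (𝔸 := 𝔸)).isBigO_sub_partialSum_pow 3).comp_tendsto hz
  have hcube : (fun z : 𝕜 => ‖z • B‖ ^ 3) =o[𝓝 0] fun z : 𝕜 => z ^ 2 := by
    have hO : (fun z : 𝕜 => z • B) =O[𝓝 0] fun z : 𝕜 => z :=
      .of_bound ‖B‖ (Eventually.of_forall fun z => by rw [norm_smul, mul_comm])
    exact (hO.norm_left.pow 3).trans_isLittleO (isLittleO_pow_pow (by norm_num))
  refine (hremainder.trans_isLittleO hcube).congr_left fun z => ?_
  simp only [Function.comp_apply, zero_add, FormalMultilinearSeries.partialSum,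
    Finset.sum_range_succ, Finset.sum_range_zero, NormedSpace.expSeries_apply_eq]
  simp [pow_two, smul_smul, mul_comm]

lemma list_prod_exp [CompleteSpace 𝔸] {T : ℕ} (B : Fin T → 𝔸) :
    HasQuadraticExpansion (fun z : 𝕜 => (List.ofFn fun t => NormedSpace.exp (z • B t)).prod) 1
      (∑ t, B t) ((1 / 2 : 𝕜) • ∑ t, B t * B t + ∑ t, ∑ u ∈ Finset.Ioi t, B t * B u) := by
  induction T with
  | zero => simpa using const (𝕜 := 𝕜) (1 : 𝔸)
  | succ T ih =>
    have h := (exp (B 0)).mul (ih fun t => B t.succ)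
    simp only [List.ofFn_succ, List.prod_cons, Fin.sum_univ_succ, Fin.sum_Ioi_zero,
      Fin.sum_Ioi_succ]
    convert! h using 1
    · simp
    · simp [add_comm]
    · simp only [one_mul, mul_one, smul_add, Finset.mul_sum]
      abel

lemma map {𝔹 : Type*} [NormedRing 𝔹] [NormedAlgebra 𝕜 𝔹] (φ : 𝔸 →L[𝕜] 𝔹)
    (hf : HasQuadraticExpansion f a b c) :
    HasQuadraticExpansion (fun z => φ (f z)) (φ a) (φ b) (φ c) := by
  refine ((φ.isBigO_comp _ _).trans_isLittleO hf).congr_left fun z => ?_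
  simp

lemma tendsto_pow {f : ℂ → ℂ} {c : ℂ} (hf : HasQuadraticExpansion f 1 0 c) :
    Tendsto (fun n : ℕ => f (((√n)⁻¹ : ℝ) : ℂ) ^ n) atTop (𝓝 (Complex.exp c)) := by
  have hz : Tendsto (fun n : ℕ => (((√n)⁻¹ : ℝ) : ℂ)) atTop (𝓝 0) := by
    rw [← Complex.ofReal_zero]
    exact (Complex.continuous_ofReal.tendsto 0).comp
      (tendsto_inv_atTop_zero.comp (Real.tendsto_sqrt_atTop.comp tendsto_natCast_atTop_atTop))
  have hsq (n : ℕ) : (((√n)⁻¹ : ℝ) : ℂ) ^ 2 = 1 / n := by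
    rw [← Complex.ofReal_pow, inv_pow, Real.sq_sqrt n.cast_nonneg]
    simp
  refine Complex.tendsto_pow_exp_of_isLittleO_sub_add_div c ?_
  refine (hf.comp_tendsto hz).congr (fun n => ?_) hsq
  simp only [Function.comp_apply, mul_zero, add_zero, hsq, smul_eq_mul, one_div_mul_eq_div]

end HasQuadraticExpansion

end Expansion

/-! ### The quantum central limit theorem -/

section CentralLimit

variable {ι : Type*} [Fintype ι] [DecidableEq ι]

open scoped Matrix.Norms.Operator in
lemma hasQuadraticExpansion_trace_mul_prod_exp {T : ℕ} (M : Matrix ι ι ℂ)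
    (B : Fin T → Matrix ι ι ℂ) :
    HasQuadraticExpansion
      (fun z : ℂ => (M * (List.ofFn fun t => NormedSpace.exp (z • B t)).prod).trace) M.trace
      (M * ∑ t, B t).trace
      (M * ((1 / 2 : ℂ) • ∑ t, B t * B t + ∑ t, ∑ u ∈ Finset.Ioi t, B t * B u)).trace := by
  have h := ((HasQuadraticExpansion.const M).mul (.list_prod_exp (𝕜 := ℂ) B)).map
    (traceLinearMap ι ℂ ℂ).toContinuousLinearMap
  simp only [mul_one, zero_mul, add_zero] at h
  exact h

open scoped Matrix.Norms.Operator in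
lemma hasQuadraticExpansion_trace_mul_exp_mul_mul_exp (S B C : Matrix ι ι ℂ) :
    HasQuadraticExpansion
      (fun z : ℂ => (S * NormedSpace.exp (z • B) * S * NormedSpace.exp (z • C)).trace)
      (S * S).trace (S * S * C + S * B * S).trace
      (S * S * ((1 / 2 : ℂ) • (C * C)) + S * B * S * C
        + S * ((1 / 2 : ℂ) • (B * B)) * S).trace := by
  have h := ((((HasQuadraticExpansion.const S).mul (.exp (𝕜 := ℂ) B)).mul (.const S)).mul
    (.exp C)).map (traceLinearMap ι ℂ ℂ).toContinuousLinearMap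
  simp only [mul_one, mul_zero, zero_mul, add_zero, zero_add] at h
  exact h

theorem tendsto_trace_mul_prod_expI_iidSum {ρ : Matrix ι ι ℂ} (hρ : ρ.trace = 1) {T : ℕ}
    {A : Fin T → Matrix ι ι ℂ} (hA : ∀ t, (ρ * A t).trace = 0) :
    Tendsto (fun n => (tensorPow n ρ * (List.ofFn fun t => expI (iidSum n (A t))).prod).trace)
      atTop (𝓝 (Complex.exp (-(1 / 2) * ∑ t, (A t * ρ * A t).trace -
        ∑ t, ∑ u ∈ Finset.Ioi t, (A u * ρ * A t).trace))) := by
  have h := hasQuadraticExpansion_trace_mul_prod_exp ρ fun t => Complex.I • A t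
  have hmean : (ρ * ∑ t, Complex.I • A t).trace = 0 := by
    simp [Matrix.mul_sum, trace_sum, hA]
  have hcyc (t u) : (A u * ρ * A t).trace = (ρ * (A t * A u)).trace := by
    rw [Matrix.mul_assoc, trace_mul_comm, Matrix.mul_assoc]
  rw [hmean, hρ] at h
  convert! h.tendsto_pow using 1
  · ext n
    simp only [expI_iidSum, ← tensorPowHom_apply]
    rw [← Function.comp_def (tensorPowHom n), ← List.map_ofFn, ← map_list_prod, ← map_mul,
      tensorPowHom_apply, trace_tensorPow]
  · congr 2
    simp [Matrix.mul_add, Matrix.mul_sum, smul_smul, hcyc, sub_eq_add_neg]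

theorem tendsto_trace_msqrt_mul_expI_iidSum {ρ : Matrix ι ι ℂ} (hρ : IsState ρ)
    {A B : Matrix ι ι ℂ} (hA : (ρ * A).trace = 0) (hB : (ρ * B).trace = 0) :
    Tendsto (fun n => (msqrt (tensorPow n ρ) * expI (iidSum n A) * msqrt (tensorPow n ρ) *
        expI (iidSum n B)).trace) atTop
      (𝓝 (Complex.exp (-(1 / 2) * ((A * ρ * A).trace + (B * B * ρ).trace) -
        (A * msqrt ρ * B * msqrt ρ).trace))) := by
  have hsqrt := msqrt_mul_msqrt hρ.posSemidef
  have hcyc (M : Matrix ι ι ℂ) : (msqrt ρ * M * msqrt ρ).trace = (ρ * M).trace := by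
    rw [trace_mul_comm, ← Matrix.mul_assoc, hsqrt]
  have h := hasQuadraticExpansion_trace_mul_exp_mul_mul_exp (msqrt ρ) (Complex.I • A)
    (Complex.I • B)
  have hmean : (ρ * (Complex.I • B) + msqrt ρ * (Complex.I • A) * msqrt ρ).trace = 0 := by
    rw [trace_add, hcyc]
    simp [hA, hB]
  rw [hsqrt, hmean, hρ.trace_eq_one] at h
  convert! h.tendsto_pow using 1
  · ext n
    simp only [expI_iidSum]
    rw [msqrt_tensorPow hρ.posSemidef]
    simp only [← tensorPowHom_apply, ← map_mul]
    rw [tensorPowHom_apply, trace_tensorPow]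
  · have hAA : (A * ρ * A).trace = (ρ * (A * A)).trace := by
      rw [Matrix.mul_assoc, trace_mul_comm, Matrix.mul_assoc]
    have hAB : (A * msqrt ρ * B * msqrt ρ).trace = (msqrt ρ * A * msqrt ρ * B).trace := by
      rw [trace_mul_comm]
      simp only [Matrix.mul_assoc]
    congr 2
    rw [trace_add, trace_add, hcyc, hAA, hAB, trace_mul_comm (B * B)]
    simp only [Matrix.mul_smul, Matrix.smul_mul, smul_smul, trace_smul, smul_eq_mul, mul_assoc,
      Complex.I_mul_I]
    ring

end CentralLimit

/-! ### The limiting Gaussian characteristic functions -/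

section Gaussian

variable {r : ℕ}

lemma gaussianQuasiChar_zero (J : Matrix (Fin r) (Fin r) ℂ) {T : ℕ} (ξ : Fin T → Fin r → ℝ) :
    gaussianQuasiChar 0 J ξ =
      Complex.exp (-(1 / 2) * ∑ t, toC (ξ t) ⬝ᵥ J *ᵥ toC (ξ t) -
        ∑ t, ∑ u ∈ Finset.Ioi t, toC (ξ u) ⬝ᵥ J *ᵥ toC (ξ t)) := by
  have hform (x y : Fin r → ℝ) :
      ∑ i, ∑ j, (x i : ℂ) * (y j : ℂ) * J j i = toC y ⬝ᵥ J *ᵥ toC x := by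
    rw [Finset.sum_comm]
    simp only [dotProduct, mulVec, toC, Finset.mul_sum]
    exact Finset.sum_congr rfl fun j _ => Finset.sum_congr rfl fun i _ => by ring
  simp only [gaussianQuasiChar, hform]
  simp [Finset.mul_sum]

lemma norm_gaussianQuasiChar_zero (J : Matrix (Fin r) (Fin r) ℂ) (ξ : Fin r → ℝ) :
    ‖gaussianQuasiChar 0 J fun _ : Fin 1 => ξ‖ = Real.exp (-(1 / 2) * (ξ ⬝ᵥ rePart J *ᵥ ξ)) := by
  rw [gaussianQuasiChar_zero, Complex.norm_exp, dotProduct_rePart_mulVec, ← Complex.re_ofReal_mul]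
  simp

variable {ι : Type*} [Fintype ι] [DecidableEq ι] {ρ : Matrix ι ι ℂ} {X : Fin r → Matrix ι ι ℂ}

omit [DecidableEq ι] in
lemma trace_mul_lin (hmean : ∀ i, (ρ * X i).trace = 0) (ξ : Fin r → ℝ) :
    (ρ * lin ξ X).trace = 0 := by
  simp [lin, Matrix.mul_sum, hmean]

omit [DecidableEq ι] in
lemma dotProduct_transpose_covMatrix_mulVec (ξ η : Fin r → ℝ) :
    toC ξ ⬝ᵥ (covMatrix ρ X)ᵀ *ᵥ toC η = (lin ξ X * lin η X * ρ).trace := by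
  classical
  rw [transpose_covMatrix_eq_traceFormMatrix, dotProduct_traceFormMatrix_mulVec, Matrix.mul_one]
  rfl

lemma dotProduct_crossCovMatrix_mulVec (ξ η : Fin r → ℝ) :
    toC ξ ⬝ᵥ crossCovMatrix ρ X *ᵥ toC η = (lin ξ X * msqrt ρ * lin η X * msqrt ρ).trace := by
  rw [crossCovMatrix_eq_traceFormMatrix, dotProduct_traceFormMatrix_mulVec]
  rfl

lemma dotProduct_fromBlocks_covMatrix_mulVec (ξ η : Fin r → ℝ) :
    toC (Sum.elim ξ η) ⬝ᵥ (fromBlocks (covMatrix ρ X) (crossCovMatrix ρ X) (crossCovMatrix ρ X)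
        (covMatrix ρ X)ᵀ) *ᵥ toC (Sum.elim ξ η) =
      (lin ξ X * ρ * lin ξ X).trace + (lin η X * lin η X * ρ).trace +
        2 * (lin ξ X * msqrt ρ * lin η X * msqrt ρ).trace := by
  have htoC : toC (Sum.elim ξ η) = Sum.elim (toC ξ) (toC η) := by
    ext (i | i) <;> rfl
  have hsymm : (lin η X * msqrt ρ * lin ξ X * msqrt ρ).trace =
      (lin ξ X * msqrt ρ * lin η X * msqrt ρ).trace := by
    rw [Matrix.mul_assoc, trace_mul_comm, ← Matrix.mul_assoc]
  rw [htoC, fromBlocks_mulVec, sumElim_dotProduct_sumElim]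
  simp only [Sum.elim_comp_inl, Sum.elim_comp_inr, dotProduct_add, dotProduct_covMatrix_mulVec,
    dotProduct_transpose_covMatrix_mulVec, dotProduct_crossCovMatrix_mulVec, hsymm]
  ring

theorem convergesToGaussian_iidSum (hρ : ρ.trace = 1) (hmean : ∀ i, (ρ * X i).trace = 0) :
    ConvergesToGaussian (fun n => tensorPow n ρ) (fun n i => iidSum n (X i)) 0
      (covMatrix ρ X) := by
  intro T ξ
  simpa only [gaussianQuasiChar_zero, dotProduct_covMatrix_mulVec, lin_iidSum] using
    tendsto_trace_mul_prod_expI_iidSum hρ fun t => trace_mul_lin hmean (ξ t)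

theorem tendsto_sandwiched_iidSum (hρ : IsState ρ) (hmean : ∀ i, (ρ * X i).trace = 0)
    (ξ η : Fin r → ℝ) :
    Tendsto (fun n => (msqrt (tensorPow n ρ) * expI (lin ξ fun i => iidSum n (X i)) *
        msqrt (tensorPow n ρ) * expI (lin η fun i => iidSum n (X i))).trace) atTop
      (𝓝 (Complex.exp (-(1 / 2) * (toC (Sum.elim ξ η) ⬝ᵥ
        (fromBlocks (covMatrix ρ X) (crossCovMatrix ρ X) (crossCovMatrix ρ X)
          (covMatrix ρ X)ᵀ) *ᵥ toC (Sum.elim ξ η))))) := by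
  simp only [dotProduct_fromBlocks_covMatrix_mulVec, lin_iidSum]
  convert! tendsto_trace_msqrt_mul_expI_iidSum hρ (trace_mul_lin hmean ξ) (trace_mul_lin hmean η)
    using 3
  ring

end Gaussian

/-! ### D-extensions of the i.i.d. model -/

section DExtension

lemma card_le_card_of_span_range_le {K V α β : Type*} [DivisionRing K] [AddCommGroup V]
    [Module K V] [Fintype α] [Fintype β] {v : α → V} {w : β → V} (hv : LinearIndependent K v)
    (h : Submodule.span K (Set.range v) ≤ Submodule.span K (Set.range w)) :
    Fintype.card α ≤ Fintype.card β := by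
  have := FiniteDimensional.span_of_finite K (Set.finite_range w)
  rw [← finrank_span_eq_card hv]
  exact (Submodule.finrank_mono h).trans (finrank_range_le_card w)

variable {ι : Type*} [Fintype ι] [DecidableEq ι] {d r : ℕ} {ρ : Matrix ι ι ℂ}
  {L : Fin d → Matrix ι ι ℂ}

-- If `ξ^k L_k = 0`, the characteristic function in the direction `ξ` is constantly `1`.
lemma linearIndependent_of_convergesToGaussian (hρ : ρ.trace = 1)
    {J : Matrix (Fin d) (Fin d) ℂ} (hJ : (rePart J).PosDef)
    (h : ConvergesToGaussian (fun n => tensorPow n ρ) (fun n k => iidSum n (L k)) 0 J) :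
    LinearIndependent ℝ L := by
  refine Fintype.linearIndependent_iff.2 fun ξ hξ => congrFun ?_
  have hlin : lin ξ L = 0 := by simpa only [lin, Complex.coe_smul] using hξ
  have hone (n : ℕ) : (tensorPow n ρ * (List.ofFn fun _ : Fin 1 =>
      expI (lin ξ fun k => iidSum n (L k))).prod).trace = 1 := by
    rw [lin_iidSum, hlin, iidSum_eq_sum_place]
    simp [expI, trace_tensorPow, hρ]
  have hlim : gaussianQuasiChar 0 J (fun _ : Fin 1 => ξ) = 1 :=
    tendsto_nhds_unique (h 1 fun _ => ξ) (by simp only [hone, tendsto_const_nhds])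
  have hform : ξ ⬝ᵥ rePart J *ᵥ ξ = 0 := by
    simpa [norm_gaussianQuasiChar_zero] using congrArg norm hlim
  by_contra hne
  exact (hJ.dotProduct_mulVec_pos hne).ne' hform

theorem exists_dExtensionConditions_iid (hρ : IsState ρ) {X : Fin r → Matrix ι ι ℂ}
    (hX : IsInvariantExtension ρ X L)
    (hXind : LinearIndependent ℝ fun i => (kerSpace ρ).mkQ (X i))
    (hmean : ∀ i, (ρ * X i).trace = 0) :
    ∃ F : Matrix (Fin r) (Fin d) ℝ,
      DExtensionConditions (fun n => tensorPow n ρ) (fun n k => iidSum n (L k))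
        (fun n i => iidSum n (X i)) F (covMatrix ρ X) := by
  have hL (k) : ∃ c : Fin r → ℝ, lin c X = L k := by
    simpa only [lin, Complex.coe_smul] using
      (Submodule.mem_span_range_iff_exists_fun ℝ).1 (hX.span_le (Submodule.subset_span ⟨k, rfl⟩))
  choose c hc using hL
  have hpos := rePart_covMatrix_posDef hρ.posSemidef hX.isHermitian hXind
  exact ⟨Matrix.of fun i k => c k i,
    { isHermitian := fun n i => iidSum_isHermitian (hX.isHermitian i)
      eq_lin := fun n k => by
        rw [← hc k, ← lin_iidSum]
        rfl
      posSemidef := covMatrix_posSemidef hρ.posSemidef hX.isHermitian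
      re_posDef := hpos
      converges := convergesToGaussian_iidSum hρ.trace_eq_one hmean
      sandwiched := ⟨crossCovMatrix ρ X,
        isGeometricMean_crossCovMatrix hρ.posSemidef hX.isHermitian hX.invariant hpos,
        tendsto_sandwiched_iidSum hρ hmean⟩ }⟩

end DExtension

end QuantumIID

end

theorem theoremC1 {ι : Type*} [Fintype ι] [DecidableEq ι] {d r : ℕ}
    (Θ : Set (Fin d → ℝ)) (ρ : (Fin d → ℝ) → Matrix ι ι ℂ)
    (hρ : ∀ θ ∈ Θ, QuantumIID.IsState (ρ θ))
    (θ₀ : Fin d → ℝ) (hθ₀ : Θ ∈ 𝓝 θ₀)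
    (L : Fin d → Matrix ι ι ℂ) (hL : QuantumIID.IsSLD ρ θ₀ L)
    (X : Fin r → Matrix ι ι ℂ) (hX : QuantumIID.IsInvariantExtension (ρ θ₀) X L)
    (hXind : LinearIndependent ℝ fun i => (QuantumIID.kerSpace (ρ θ₀)).mkQ (X i))
    (hXmean : ∀ i, (ρ θ₀ * X i).trace = 0) :
    -- the three conditions of a D-extension, with `Σ_{ij} = Tr ρ X_j X_i`
    (∃ F : Matrix (Fin r) (Fin d) ℝ,
      QuantumIID.DExtensionConditions
        (fun n => QuantumIID.tensorPow n (ρ θ₀))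
        (fun n k => QuantumIID.iidSum n (L k))
        (fun n i => QuantumIID.iidSum n (X i))
        F (QuantumIID.covMatrix (ρ θ₀) X)) ∧
    -- the cross-covariance is `Σ # Σᵀ`
    QuantumIID.IsGeometricMean (QuantumIID.covMatrix (ρ θ₀) X)
      (QuantumIID.covMatrix (ρ θ₀) X).transpose (QuantumIID.crossCovMatrix (ρ θ₀) X) ∧
    -- `r ≥ d` as soon as the SLDs are linearly independent
    (LinearIndependent ℝ L → d ≤ r) ∧
    -- the i.i.d. extension is D-extendible at `θ₀` in every case where it is q-LAN there
    (∀ J : Matrix (Fin d) (Fin d) ℂ,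
      QuantumIID.IsQLAN Θ (fun n θ => QuantumIID.tensorPow n (ρ θ)) θ₀
        (fun n k => QuantumIID.iidSum n (L k)) J →
      d ≤ r ∧
      QuantumIID.IsDExtendible Θ (fun n θ => QuantumIID.tensorPow n (ρ θ)) θ₀
        (fun n k => QuantumIID.iidSum n (L k)) J) := by
  have hstate := hρ θ₀ (mem_of_mem_nhds hθ₀)
  have hext := QuantumIID.exists_dExtensionConditions_iid hstate hX hXind hXmean
  have hcard (hLind : LinearIndependent ℝ L) : d ≤ r := by
    simpa using QuantumIID.card_le_card_of_span_range_le hLind hX.span_le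
  refine ⟨hext, QuantumIID.isGeometricMean_crossCovMatrix hstate.posSemidef hX.isHermitian
    hX.invariant (QuantumIID.rePart_covMatrix_posDef hstate.posSemidef hX.isHermitian hXind),
    hcard, fun J hJ => ?_⟩
  have hdr := hcard (QuantumIID.linearIndependent_of_convergesToGaussian hstate.trace_eq_one
    hJ.re_posDef hJ.converges)
  obtain ⟨F, hF⟩ := hext
  exact ⟨hdr, hJ, r, hdr, _, F, _, hF⟩
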